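/- Let $(M,g)$ and $(N,h)$ be smooth finite-dimensional Riemannian manifolds (without boundary), $m=\dim M$, with Levi-Civita connections $\nabla$ and $\nabla^N$, and let $\varphi:M\to N$ be a smooth map. Let $\overline\nabla$ be the connection on $\varphi^{-1}TN$ induced by $\nabla^N$. Here $\{e_i\}_{i=1}^m$ always denotes a local orthonormal frame field of $(M,g)$, and $|V|^2=h(V,V)$ for $V\in\Gamma(\varphi^{-1}TN)$. The tension field of $\varphi$ is $$\tau(\varphi)=\sum_{i=1}^m\bigl\{\overline\nabla_{e_i}(d\varphi(e_i))-d\varphi(\nabla_{e_i}e_i)\bigr\}\in\Gamma(\varphi^{-1}TN).$$ With $R^N(U,V)=\nabla^N_U\nabla^N_V-\nabla^N_V\nabla^N_U-\nabla^N_{[U,V]}$, the map $\varphi$ is called biharmonic if its bitension field vanishes on $M$, that is, $$\tau_2(\varphi):=-\sum_{i=1}^m\bigl\{\overline\nabla_{e_i}\overline\nabla_{e_i}\tau(\varphi)-\overline\nabla_{\nabla_{e_i}e_i}\tau(\varphi)\bigr\}-\sum_{i=1}^m R^N(\tau(\varphi),d\varphi(e_i))\,d\varphi(e_i)=0 .$$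 Lemma 4.2. Assume that all sectional curvatures of $(N,h)$ are non-positive and that $\varphi:(M,g)\to(N,h)$ is biharmonic. Then, at every point of $M$, $$\Delta\,|\tau(\varphi)|^2\;\ge\;2\,|\overline\nabla\tau(\varphi)|^2,$$ where $\Delta=\sum_{i=1}^m(e_i^2-\nabla_{e_i}e_i)$ is the Laplace-Beltrami operator of $(M,g)$ and $|\overline\nabla\tau(\varphi)|^2=\sum_{i=1}^m|\overline\nabla_{e_i}\tau(\varphi)|^2$. -/

import Mathlib

open scoped Manifold ContDiff Bundle Topology
open Bundle

set_option linter.unusedSectionVars false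

noncomputable section

namespace RiemannianGeometry

/-! ## The Levi-Civita connection of a Riemannian manifold -/

section Connection

variable {E : Type*} [NormedAddCommGroup E] [NormedSpace ℝ E] [FiniteDimensional ℝ E]
  {H : Type*} [TopologicalSpace H] (I : ModelWithCorners ℝ E H)
  {M : Type*} [TopologicalSpace M] [ChartedSpace H M] [IsManifold I ∞ M]
  [RiemannianBundle (fun x : M ↦ TangentSpace I x)]

instance (x : M) : FiniteDimensional ℝ (TangentSpace I x) :=
  inferInstanceAs (FiniteDimensional ℝ E)

/-- An orthonormal basis of the tangent space `T_x M` for the given Riemannian metric. -/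
abbrev tangentONB (x : M) :
    OrthonormalBasis (Fin (Module.finrank ℝ (TangentSpace I x))) ℝ (TangentSpace I x) :=
  stdOrthonormalBasis ℝ (TangentSpace I x)

/-- The differential at `x` of the function `⟨X, Y⟩` on `M`. -/
def dInner (X Y : Π x : M, TangentSpace I x) (x : M) : TangentSpace I x →L[ℝ] ℝ :=
  mvfderiv I (fun y ↦ (inner ℝ (X y) (Y y) : ℝ)) x

/-- The right-hand side of the Koszul formula for `⟨∇_X Y, Z⟩`. -/
def koszul (X Y Z : Π x : M, TangentSpace I x) (x : M) : ℝ :=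
  (dInner I Y Z x (X x) + dInner I Z X x (Y x) - dInner I X Y x (Z x)
    + inner ℝ (VectorField.mlieBracket I X Y x) (Z x)
    - inner ℝ (VectorField.mlieBracket I Y Z x) (X x)
    + inner ℝ (VectorField.mlieBracket I Z X x) (Y x)) / 2

/-- `leviCivitaFun I Y x v` is the vector `∇_v Y` of `T_x M` determined by the Koszul formula. It is
computed in an orthonormal basis of `T_x M`, whose members are extended to smooth local vector
fields by `FiberBundle.extend`. -/
def leviCivitaFun (Y : Π x : M, TangentSpace I x) (x : M) :
    TangentSpace I x →L[ℝ] TangentSpace I x :=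
  ∑ i, ∑ j, koszul I (FiberBundle.extend E (tangentONB I x i)) Y
      (FiberBundle.extend E (tangentONB I x j)) x •
    (innerSL ℝ (tangentONB I x i)).smulRight (tangentONB I x j)

variable [IsContMDiffRiemannianBundle I ∞ E (fun x : M ↦ TangentSpace I x)]

variable {I}

lemma mdifferentiableAt_inner {X Y : Π x : M, TangentSpace I x} {x : M}
    (hX : MDiffAt (T% X) x) (hY : MDiffAt (T% Y) x) :
    MDiffAt (fun y ↦ (inner ℝ (X y) (Y y) : ℝ)) x :=
  MDifferentiableAt.inner_bundle (F := E) (E := fun x : M ↦ TangentSpace I x) hX hY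

lemma dInner_smul {f : M → ℝ} {X Y : Π x : M, TangentSpace I x} {x : M} (hf : MDiffAt f x)
    (hX : MDiffAt (T% X) x) (hY : MDiffAt (T% Y) x) (v : TangentSpace I x) :
    dInner I (f • X) Y x v =
      f x * dInner I X Y x v + inner ℝ (X x) (Y x) * mvfderiv I f x v := by
  have h1 := mvfderiv_mul hf (mdifferentiableAt_inner hX hY)
  simp only [Pi.mul_def] at h1
  simp only [dInner, Pi.smul_apply', real_inner_smul_left, h1]
  rfl

lemma dInner_add {X X' Y : Π x : M, TangentSpace I x} {x : M}
    (hX : MDiffAt (T% X) x) (hX' : MDiffAt (T% X') x) (hY : MDiffAt (T% Y) x)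
    (v : TangentSpace I x) :
    dInner I (X + X') Y x v = dInner I X Y x v + dInner I X' Y x v := by
  have h1 := mvfderiv_add (mdifferentiableAt_inner hX hY) (mdifferentiableAt_inner hX' hY)
  simp only [Pi.add_def] at h1
  simp only [dInner, Pi.add_apply, inner_add_left, h1]
  rfl

lemma dInner_comm (X Y : Π x : M, TangentSpace I x) (x : M) :
    dInner I X Y x = dInner I Y X x := by
  simp only [dInner, real_inner_comm]

lemma koszul_smul_left {f : M → ℝ} {X Y Z : Π x : M, TangentSpace I x} {x : M}
    (hf : MDiffAt f x)
    (hX : MDiffAt (T% X) x) (hY : MDiffAt (T% Y) x) (hZ : MDiffAt (T% Z) x) :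
    koszul I (f • X) Y Z x = f x • koszul I X Y Z x := by
  have : IsManifold I 2 M := .of_le (n := ∞) (by norm_cast)
  have h1 := dInner_smul hf hX hZ (Y x)
  have h2 := dInner_smul hf hX hY (Z x)
  have e1 := VectorField.mlieBracket_smul_left (W := Y) hf hX
  have e2 := VectorField.mlieBracket_smul_right (V := Z) hf hX
  simp only [koszul, dInner_comm Z (f • X), e1, e2, Pi.smul_apply', h1, h2, dInner_comm Z X,
    inner_add_left, real_inner_smul_left, real_inner_smul_right, smul_eq_mul, map_smul, neg_smul,
    inner_neg_left]
  ring

lemma koszul_add_left {X X' Y Z : Π x : M, TangentSpace I x} {x : M}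
    (hX : MDiffAt (T% X) x) (hX' : MDiffAt (T% X') x)
    (hY : MDiffAt (T% Y) x) (hZ : MDiffAt (T% Z) x) :
    koszul I (X + X') Y Z x = koszul I X Y Z x + koszul I X' Y Z x := by
  have : IsManifold I 2 M := .of_le (n := ∞) (by norm_cast)
  have h1 := dInner_add hX hX' hZ (Y x)
  have h2 := dInner_add hX hX' hY (Z x)
  have e1 := VectorField.mlieBracket_add_left (W := Y) hX hX'
  have e2 := VectorField.mlieBracket_add_right (V := Z) hX hX'
  simp only [koszul, dInner_comm Z (X + X'), e1, e2, Pi.add_apply, h1, h2, dInner_comm Z X,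
    dInner_comm Z X', inner_add_left, inner_add_right, map_add]
  ring

lemma koszul_smul_right {f : M → ℝ} {X Y Z : Π x : M, TangentSpace I x} {x : M}
    (hf : MDiffAt f x)
    (hX : MDiffAt (T% X) x) (hY : MDiffAt (T% Y) x) (hZ : MDiffAt (T% Z) x) :
    koszul I X Y (f • Z) x = f x • koszul I X Y Z x := by
  have : IsManifold I 2 M := .of_le (n := ∞) (by norm_cast)
  have h1 := dInner_smul hf hZ hY (X x)
  have h2 := dInner_smul hf hZ hX (Y x)
  have e1 := VectorField.mlieBracket_smul_left (W := X) hf hZ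
  have e2 := VectorField.mlieBracket_smul_right (V := Y) hf hZ
  simp only [koszul, dInner_comm Y (f • Z), e1, e2, Pi.smul_apply', h1, h2, dInner_comm Y Z,
    inner_add_left, real_inner_smul_left, real_inner_smul_right, smul_eq_mul, map_smul, neg_smul,
    inner_neg_left, real_inner_comm (Z x)]
  ring

lemma koszul_add_right {X Y Z Z' : Π x : M, TangentSpace I x} {x : M}
    (hX : MDiffAt (T% X) x) (hY : MDiffAt (T% Y) x)
    (hZ : MDiffAt (T% Z) x) (hZ' : MDiffAt (T% Z') x) :
    koszul I X Y (Z + Z') x = koszul I X Y Z x + koszul I X Y Z' x := by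
  have : IsManifold I 2 M := .of_le (n := ∞) (by norm_cast)
  have h1 := dInner_add hZ hZ' hY (X x)
  have h2 := dInner_add hZ hZ' hX (Y x)
  have e1 := VectorField.mlieBracket_add_left (W := X) hZ hZ'
  have e2 := VectorField.mlieBracket_add_right (V := Y) hZ hZ'
  simp only [koszul, dInner_comm Y (Z + Z'), e1, e2, Pi.add_apply, h1, h2, dInner_comm Y Z,
    dInner_comm Y Z', inner_add_left, inner_add_right, map_add]
  ring

lemma koszul_smul_middle {f : M → ℝ} {X Y Z : Π x : M, TangentSpace I x} {x : M}
    (hf : MDiffAt f x)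
    (hX : MDiffAt (T% X) x) (hY : MDiffAt (T% Y) x) (hZ : MDiffAt (T% Z) x) :
    koszul I X (f • Y) Z x = f x • koszul I X Y Z x + inner ℝ (Y x) (Z x) * mvfderiv I f x (X x) := by
  have : IsManifold I 2 M := .of_le (n := ∞) (by norm_cast)
  have h1 := dInner_smul hf hY hZ (X x)
  have h2 := dInner_smul hf hY hX (Z x)
  have e1 := VectorField.mlieBracket_smul_left (W := Z) hf hY
  have e2 := VectorField.mlieBracket_smul_right (V := X) hf hY
  simp only [koszul, dInner_comm X (f • Y), e1, e2, Pi.smul_apply', h1, h2, dInner_comm X Y,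
    inner_add_left, real_inner_smul_left, real_inner_smul_right, smul_eq_mul, map_smul, neg_smul,
    inner_neg_left, real_inner_comm (Y x)]
  ring

lemma koszul_add_middle {X Y Y' Z : Π x : M, TangentSpace I x} {x : M}
    (hX : MDiffAt (T% X) x) (hY : MDiffAt (T% Y) x) (hY' : MDiffAt (T% Y') x)
    (hZ : MDiffAt (T% Z) x) :
    koszul I X (Y + Y') Z x = koszul I X Y Z x + koszul I X Y' Z x := by
  have : IsManifold I 2 M := .of_le (n := ∞) (by norm_cast)
  have h1 := dInner_add hY hY' hZ (X x)
  have h2 := dInner_add hY hY' hX (Z x)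
  have e1 := VectorField.mlieBracket_add_left (W := Z) hY hY'
  have e2 := VectorField.mlieBracket_add_right (V := X) hY hY'
  simp only [koszul, dInner_comm X (Y + Y'), e1, e2, Pi.add_apply, h1, h2, dInner_comm X Y,
    dInner_comm X Y', inner_add_left, inner_add_right, map_add]
  ring

/-- The Koszul formula. -/
lemma inner_leviCivitaFun {X Y Z : Π x : M, TangentSpace I x} {x : M}
    (hX : MDiffAt (T% X) x) (hY : MDiffAt (T% Y) x) (hZ : MDiffAt (T% Z) x) :
    inner ℝ (leviCivitaFun I Y x (X x)) (Z x) = koszul I X Y Z x := by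
  have H₁ : ∀ Z' : Π x : M, TangentSpace I x, MDiffAt (T% Z') x →
      TensorialAt I E (fun X' ↦ koszul I X' Y Z' x) x := fun Z' hZ' ↦
    ⟨fun hf hX' ↦ koszul_smul_left hf hX' hY hZ', fun h h' ↦ koszul_add_left h h' hY hZ'⟩
  have H₂ : ∀ X' : Π x : M, TangentSpace I x, MDiffAt (T% X') x →
      TensorialAt I E (fun Z' ↦ koszul I X' Y Z' x) x := fun X' hX' ↦
    ⟨fun hf hZ' ↦ koszul_smul_right hf hX' hY hZ', fun h h' ↦ koszul_add_right hX' hY h h'⟩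
  have key := TensorialAt.mkHom₂_apply (Φ := fun X' Z' ↦ koszul I X' Y Z' x) H₁ H₂ hX hZ
  have key2 := TensorialAt.mkHom₂_apply_eq_extend (Φ := fun X' Z' ↦ koszul I X' Y Z' x) H₁ H₂
  rw [← key]
  generalize TensorialAt.mkHom₂ (fun X' Z' ↦ koszul I X' Y Z' x) x H₁ H₂ = B at key2
  conv_rhs => rw [← (tangentONB I x).sum_repr (X x), ← (tangentONB I x).sum_repr (Z x)]
  simp only [map_sum, sum_apply, map_smul, smul_apply, key2]
  simp only [leviCivitaFun, sum_apply, smul_apply,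
    ContinuousLinearMap.smulRight_apply, sum_inner, real_inner_smul_left,
    OrthonormalBasis.repr_apply_apply, innerSL_apply_apply, smul_eq_mul]
  simp only [Finset.mul_sum]
  rw [Finset.sum_comm]
  refine Finset.sum_congr rfl fun j _ ↦ Finset.sum_congr rfl fun i _ ↦ ?_
  ring

lemma ext_inner_extend {x : M} {u w : TangentSpace I x →L[ℝ] TangentSpace I x}
    (h : ∀ X Z : Π x : M, TangentSpace I x, MDiffAt (T% X) x → MDiffAt (T% Z) x →
      inner ℝ (u (X x)) (Z x) = inner ℝ (w (X x)) (Z x)) : u = w := by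
  ext v
  refine ext_inner_right ℝ fun z ↦ ?_
  simpa using h (FiberBundle.extend E v) (FiberBundle.extend E z) (FiberBundle.mdifferentiableAt_extend ..)
    (FiberBundle.mdifferentiableAt_extend ..)

variable (I M) in
/-- The Levi-Civita connection of the Riemannian manifold `M`, as a connection on `TM`. In Mathlib's
argument order, `leviCivita I M Y x (X x)` is `(∇_X Y)(x)`. -/
def leviCivita : CovariantDerivative I E (fun x : M ↦ TangentSpace I x) where
  toFun := leviCivitaFun I
  isCovariantDerivativeOnUniv :=
    { add := fun {Y Y' x} hY hY' _ ↦ by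
        refine ext_inner_extend fun X Z hX hZ ↦ ?_
        have hYY' := mdifferentiableAt_add_section hY hY'
        rw [inner_leviCivitaFun hX hYY' hZ, koszul_add_middle hX hY hY' hZ]
        simp [inner_add_left, inner_leviCivitaFun, hX, hY, hY', hZ]
      leibniz := fun {Y f x} hY hf _ ↦ by
        refine ext_inner_extend fun X Z hX hZ ↦ ?_
        have hfY := hf.smul_section hY
        rw [inner_leviCivitaFun hX hfY hZ, koszul_smul_middle hf hX hY hZ]
        simp [inner_add_left, real_inner_smul_left, inner_leviCivitaFun, hX, hY, hZ]
        ring }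

/-- The Levi-Civita connection is torsion-free. -/
lemma leviCivita_torsion : (leviCivita I M).torsion = 0 := by
  have : CompleteSpace E := FiniteDimensional.complete ℝ E
  rw [CovariantDerivative.torsion_eq_zero_iff]
  intro X Y x hX hY
  refine ext_inner_right ℝ fun z ↦ ?_
  have hZ := FiberBundle.mdifferentiableAt_extend I E z
  have h1 := inner_leviCivitaFun hX hY hZ
  have h2 := inner_leviCivitaFun hY hX hZ
  rw [FiberBundle.extend_apply_self] at h1 h2
  rw [inner_sub_left]
  change inner ℝ (leviCivitaFun I Y x (X x)) z - inner ℝ (leviCivitaFun I X x (Y x)) z = _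
  rw [h1, h2]
  simp only [koszul, dInner_comm X Y, VectorField.mlieBracket_swap_apply (V := Y) (W := X),
    VectorField.mlieBracket_swap_apply (V := FiberBundle.extend E z) , inner_neg_left,
    FiberBundle.extend_apply_self, dInner_comm X (FiberBundle.extend E z),
    dInner_comm Y (FiberBundle.extend E z)]
  ring

/-- The Levi-Civita connection is compatible with the metric. -/
lemma leviCivita_metric {X Y Z : Π x : M, TangentSpace I x} {x : M}
    (hX : MDiffAt (T% X) x) (hY : MDiffAt (T% Y) x) (hZ : MDiffAt (T% Z) x) :
    mvfderiv I (fun y ↦ (inner ℝ (Y y) (Z y) : ℝ)) x (X x) =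
      inner ℝ (leviCivita I M Y x (X x)) (Z x) + inner ℝ (Y x) (leviCivita I M Z x (X x)) := by
  have h1 := inner_leviCivitaFun hX hY hZ
  have h2 := inner_leviCivitaFun hX hZ hY
  change dInner I Y Z x (X x) = inner ℝ (leviCivitaFun I Y x (X x)) (Z x) + inner ℝ (Y x) (leviCivitaFun I Z x (X x))
  rw [real_inner_comm _ (Y x), h1, h2]
  simp only [koszul, dInner_comm X Y, VectorField.mlieBracket_swap_apply (V := Y) (W := X),
    VectorField.mlieBracket_swap_apply (V := Z), inner_neg_left, dInner_comm X Z, dInner_comm Y Z]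
  ring

/-! ## Curvature and the Laplace-Beltrami operator -/

variable (I)

/-- The curvature tensor `R(u, v) w = ∇_U ∇_V W - ∇_V ∇_U W - ∇_[U, V] W` at `x`, where `U`, `V`, `W`
are the smooth local extensions of `u`, `v`, `w` by `FiberBundle.extend` (by tensoriality, the choice
of the extensions does not matter). -/
def curvature {x : M} (u v w : TangentSpace I x) : TangentSpace I x :=
  let U : Π y : M, TangentSpace I y := FiberBundle.extend E u
  let V : Π y : M, TangentSpace I y := FiberBundle.extend E v
  let W : Π y : M, TangentSpace I y := FiberBundle.extend E w
  leviCivita I M (fun y ↦ leviCivita I M W y (V y)) x (U x)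
    - leviCivita I M (fun y ↦ leviCivita I M W y (U y)) x (V x)
    - leviCivita I M W x (VectorField.mlieBracket I U V x)

/-- The sectional curvature of the plane spanned by two linearly independent vectors `u`, `v`. -/
def sectionalCurvature {x : M} (u v : TangentSpace I x) : ℝ :=
  inner ℝ (curvature I u v v) u / (‖u‖ ^ 2 * ‖v‖ ^ 2 - (inner ℝ u v) ^ 2)

variable (M) in
/-- All sectional curvatures of `M` are non-positive. -/
def NonposSectionalCurvature : Prop :=
  ∀ (x : M) (u v : TangentSpace I x), LinearIndependent ℝ ![u, v] → sectionalCurvature I u v ≤ 0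

/-- The Laplace-Beltrami operator `Δ f = ∑ᵢ (eᵢ (eᵢ f) - (∇_{eᵢ} eᵢ) f)` at `x`, i.e. the trace of the
Hessian of `f`. The Hessian being a tensor, it is enough that the smooth local vector fields `eᵢ`
are orthonormal at `x`. -/
def laplacian (f : M → ℝ) (x : M) : ℝ :=
  ∑ i, (
    let e : Π y : M, TangentSpace I y := FiberBundle.extend E (tangentONB I x i)
    mvfderiv I (fun y ↦ mvfderiv I f y (e y)) x (e x)
      - mvfderiv I f x (leviCivita I M e x (e x)))

end Connection

/-! ## Sections along a map, tension field, bitension field -/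

section Maps

variable {E : Type*} [NormedAddCommGroup E] [NormedSpace ℝ E] [FiniteDimensional ℝ E]
  {H : Type*} [TopologicalSpace H] (I : ModelWithCorners ℝ E H)
  {M : Type*} [TopologicalSpace M] [ChartedSpace H M] [IsManifold I ∞ M]
  [RiemannianBundle (fun x : M ↦ TangentSpace I x)]
  [IsContMDiffRiemannianBundle I ∞ E (fun x : M ↦ TangentSpace I x)]
  {F : Type*} [NormedAddCommGroup F] [NormedSpace ℝ F] [FiniteDimensional ℝ F]
  {G : Type*} [TopologicalSpace G] (J : ModelWithCorners ℝ F G)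
  {N : Type*} [TopologicalSpace N] [ChartedSpace G N] [IsManifold J ∞ N]
  [RiemannianBundle (fun y : N ↦ TangentSpace J y)]
  [IsContMDiffRiemannianBundle J ∞ F (fun y : N ↦ TangentSpace J y)]
  (φ : M → N)

/-- The connection on `φ⁻¹TN` induced by the Levi-Civita connection of `N`: `inducedConnection I J φ V x v`
is `∇̄_v V` for a section `V` of `φ⁻¹TN`. If `(sₐ)` is the coordinate frame of `TN` near `φ x` and
`V = ∑ₐ cₐ (sₐ ∘ φ)` near `x`, then `∇̄_v V = ∑ₐ (dcₐ(v) sₐ(φ x) + cₐ(x) ∇^N_{dφ(v)} sₐ)`. -/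
def inducedConnection (V : Π x : M, TangentSpace J (φ x)) (x : M) :
    TangentSpace I x →L[ℝ] TangentSpace J (φ x) :=
  let t := trivializationAt F (fun y : N ↦ TangentSpace J y) (φ x)
  let b := Module.finBasis ℝ F
  let c := fun a (y : M) ↦ t.localFrameCoeff J b a (φ y) (V y)
  let s := fun a ↦ t.localFrame b a
  ∑ a, ((mvfderiv I (c a) x).smulRight (s a (φ x))
    + c a x • (leviCivita J N (s a) (φ x)).comp (mfderiv I J φ x))

/-- The second fundamental form `B(φ)(X, Y) = ∇̄_X (dφ(Y)) - dφ(∇_X Y)` at `x`. -/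
def secondFundamentalForm (X Y : Π x : M, TangentSpace I x) (x : M) : TangentSpace J (φ x) :=
  inducedConnection I J φ (fun y ↦ mfderiv I J φ y (Y y)) x (X x)
    - mfderiv I J φ x (leviCivita I M Y x (X x))

/-- The tension field `τ(φ) = ∑ᵢ B(φ)(eᵢ, eᵢ)`. As `B(φ)` is a tensor, it is enough that the smooth
local vector fields `eᵢ` are orthonormal at the given point. -/
def tensionField (x : M) : TangentSpace J (φ x) :=
  ∑ i, (
    let e : Π y : M, TangentSpace I y := FiberBundle.extend E (tangentONB I x i)
    secondFundamentalForm I J φ e e x)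

/-- The rough Laplacian `Δ̄ V = -∑ᵢ (∇̄_{eᵢ} ∇̄_{eᵢ} V - ∇̄_{∇_{eᵢ} eᵢ} V)` of a section `V` of `φ⁻¹TN`. -/
def roughLaplacian (V : Π x : M, TangentSpace J (φ x)) (x : M) : TangentSpace J (φ x) :=
  -∑ i, (
    let e : Π y : M, TangentSpace I y := FiberBundle.extend E (tangentONB I x i)
    inducedConnection I J φ (fun y ↦ inducedConnection I J φ V y (e y)) x (e x)
      - inducedConnection I J φ V x (leviCivita I M e x (e x)))

/-- The operator `ℛ(V) = ∑ᵢ R^N(V, dφ(eᵢ)) dφ(eᵢ)`. -/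
def curvatureOperator (V : Π x : M, TangentSpace J (φ x)) (x : M) : TangentSpace J (φ x) :=
  ∑ i, curvature J (V x) (mfderiv I J φ x (tangentONB I x i)) (mfderiv I J φ x (tangentONB I x i))

/-- The Jacobi operator `J(V) = Δ̄ V - ℛ(V)`. -/
def jacobiOperator (V : Π x : M, TangentSpace J (φ x)) (x : M) : TangentSpace J (φ x) :=
  roughLaplacian I J φ V x - curvatureOperator I J φ V x

/-- The bitension field `τ₂(φ) = J(τ(φ))`. -/
def bitensionField (x : M) : TangentSpace J (φ x) :=
  jacobiOperator I J φ (tensionField I J φ) x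

/-- A smooth map is biharmonic if its bitension field vanishes. -/
def IsBiharmonic : Prop :=
  ContMDiff I J ∞ φ ∧ ∀ x, bitensionField I J φ x = 0

/-- `|∇̄V|² = ∑ᵢ |∇̄_{eᵢ} V|²` at `x`, for an orthonormal basis `(eᵢ)` of `T_x M`. -/
def normSqInducedDeriv (V : Π x : M, TangentSpace J (φ x)) (x : M) : ℝ :=
  ∑ i, ‖inducedConnection I J φ V x (tangentONB I x i)‖ ^ 2

end Maps

end RiemannianGeometry

end

namespace RiemannianGeometry

/-! ## Sections along a map -/

section Along

variable {E : Type*} [NormedAddCommGroup E] [NormedSpace ℝ E]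
  {H : Type*} [TopologicalSpace H] {I : ModelWithCorners ℝ E H}
  {M : Type*} [TopologicalSpace M] [ChartedSpace H M]
  {F : Type*} [NormedAddCommGroup F] [NormedSpace ℝ F] [FiniteDimensional ℝ F]
  {G : Type*} [TopologicalSpace G] {J : ModelWithCorners ℝ F G}
  {N : Type*} [TopologicalSpace N] [ChartedSpace G N] [IsManifold J ∞ N]
  {φ : M → N} {V W : Π x : M, TangentSpace J (φ x)} {f : M → ℝ} {x : M} {k : WithTop ℕ∞}

variable (I J) in
/-- The section `V` of `φ⁻¹TN` is differentiable at `x`. -/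
def MDiffAlong (φ : M → N) (V : Π x : M, TangentSpace J (φ x)) (x : M) : Prop :=
  MDifferentiableAt I (J.prod 𝓘(ℝ, F)) (fun y ↦ TotalSpace.mk' F (φ y) (V y)) x

variable (I J) in
/-- The section `V` of `φ⁻¹TN` is smooth at `x`. -/
def SmoothAlong (φ : M → N) (V : Π x : M, TangentSpace J (φ x)) (x : M) : Prop :=
  ContMDiffAt I (J.prod 𝓘(ℝ, F)) ∞ (fun y ↦ TotalSpace.mk' F (φ y) (V y)) x

lemma mdiffAlong_iff (t : Trivialization F (π F (fun y : N ↦ TangentSpace J y)))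
    [MemTrivializationAtlas t] (hx : φ x ∈ t.baseSet) :
    MDiffAlong I J φ V x ↔ MDifferentiableAt I J φ x ∧
      MDifferentiableAt I 𝓘(ℝ, F) (fun y ↦ (t ⟨φ y, V y⟩).2) x :=
  t.mdifferentiableAt_totalSpace_iff J _ (t.mem_source.2 hx)

lemma smoothAlong_iff (t : Trivialization F (π F (fun y : N ↦ TangentSpace J y)))
    [MemTrivializationAtlas t] (hx : φ x ∈ t.baseSet) :
    SmoothAlong I J φ V x ↔ ContMDiffAt I J ∞ φ x ∧
      ContMDiffAt I 𝓘(ℝ, F) ∞ (fun y ↦ (t ⟨φ y, V y⟩).2) x :=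
  t.contMDiffAt_iff (t.mem_source.2 hx)

lemma MDiffAlong.map (h : MDiffAlong I J φ V x) : MDifferentiableAt I J φ x :=
  ((mdiffAlong_iff (trivializationAt F _ (φ x)) (FiberBundle.mem_baseSet_trivializationAt' _)).1 h).1

lemma SmoothAlong.map (h : SmoothAlong I J φ V x) : ContMDiffAt I J ∞ φ x :=
  ((smoothAlong_iff (trivializationAt F _ (φ x)) (FiberBundle.mem_baseSet_trivializationAt' _)).1 h).1

lemma SmoothAlong.mdiffAlong (h : SmoothAlong I J φ V x) : MDiffAlong I J φ V x :=
  ContMDiffAt.mdifferentiableAt h (by simp)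

lemma eventually_mdifferentiableAt {N' : Type*} {F' : Type*} [NormedAddCommGroup F']
    [NormedSpace ℝ F'] {G' : Type*} [TopologicalSpace G'] {J' : ModelWithCorners ℝ F' G'}
    [TopologicalSpace N'] [ChartedSpace G' N'] [IsManifold I ∞ M] [IsManifold J' ∞ N'] {ψ : M → N'}
    (h : ContMDiffAt I J' ∞ ψ x) :
    ∀ᶠ y in 𝓝 x, MDifferentiableAt I J' ψ y := by
  have : IsManifold I 1 M := .of_le (n := ∞) (by norm_cast)
  have : IsManifold J' 1 N' := .of_le (n := ∞) (by norm_cast)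
  have h1 : ContMDiffAt I J' 1 ψ x := h.of_le (by norm_cast)
  filter_upwards [(contMDiffAt_iff_contMDiffAt_nhds (by simp)).1 h1] with y hy
  exact hy.mdifferentiableAt (by simp)

lemma SmoothAlong.eventually_mdiffAlong [IsManifold I ∞ M] (h : SmoothAlong I J φ V x) :
    ∀ᶠ y in 𝓝 x, MDiffAlong I J φ V y :=
  eventually_mdifferentiableAt h

lemma eventually_mem_baseSet (t : Trivialization F (π F (fun y : N ↦ TangentSpace J y)))
    (hx : φ x ∈ t.baseSet) (hφ : ContinuousAt φ x) : ∀ᶠ y in 𝓝 x, φ y ∈ t.baseSet :=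
  hφ.eventually (t.open_baseSet.mem_nhds hx)

lemma SmoothAlong.congr (h : SmoothAlong I J φ V x) (hVW : ∀ᶠ y in 𝓝 x, W y = V y) :
    SmoothAlong I J φ W x :=
  ContMDiffAt.congr_of_eventuallyEq h (hVW.mono fun y hy ↦ by simp [hy])

lemma trivialization_add {t : Trivialization F (π F (fun y : N ↦ TangentSpace J y))}
    [MemTrivializationAtlas t] {p : N} (hp : p ∈ t.baseSet) (v w : TangentSpace J p) :
    (t ⟨p, v + w⟩).2 = (t ⟨p, v⟩).2 + (t ⟨p, w⟩).2 :=
  (t.linear ℝ hp).1 v w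

lemma trivialization_smul {t : Trivialization F (π F (fun y : N ↦ TangentSpace J y))}
    [MemTrivializationAtlas t] {p : N} (hp : p ∈ t.baseSet) (c : ℝ) (v : TangentSpace J p) :
    (t ⟨p, c • v⟩).2 = c • (t ⟨p, v⟩).2 :=
  (t.linear ℝ hp).2 c v

lemma MDiffAlong.add (hV : MDiffAlong I J φ V x) (hW : MDiffAlong I J φ W x) :
    MDiffAlong I J φ (V + W) x := by
  have hx := FiberBundle.mem_baseSet_trivializationAt' (F := F) (E := fun y : N ↦ TangentSpace J y) (φ x)
  have hev := eventually_mem_baseSet _ hx hV.map.continuousAt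
  rw [mdiffAlong_iff _ hx] at *
  refine ⟨hV.1, (hV.2.add hW.2).congr_of_eventuallyEq ?_⟩
  filter_upwards [hev] with y hy
  exact trivialization_add hy _ _

lemma SmoothAlong.add (hV : SmoothAlong I J φ V x) (hW : SmoothAlong I J φ W x) :
    SmoothAlong I J φ (V + W) x := by
  have hx := FiberBundle.mem_baseSet_trivializationAt' (F := F) (E := fun y : N ↦ TangentSpace J y) (φ x)
  have hev := eventually_mem_baseSet _ hx hV.map.continuousAt
  rw [smoothAlong_iff _ hx] at *
  refine ⟨hV.1, (hV.2.add hW.2).congr_of_eventuallyEq ?_⟩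
  filter_upwards [hev] with y hy
  exact trivialization_add hy _ _

lemma MDiffAlong.smul (hf : MDifferentiableAt I 𝓘(ℝ) f x) (hV : MDiffAlong I J φ V x) :
    MDiffAlong I J φ (fun y ↦ f y • V y) x := by
  have hx := FiberBundle.mem_baseSet_trivializationAt' (F := F) (E := fun y : N ↦ TangentSpace J y) (φ x)
  have hev := eventually_mem_baseSet _ hx hV.map.continuousAt
  rw [mdiffAlong_iff _ hx] at *
  refine ⟨hV.1, (hf.smul hV.2).congr_of_eventuallyEq ?_⟩
  filter_upwards [hev] with y hy
  exact trivialization_smul hy _ _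

lemma SmoothAlong.smul (hf : ContMDiffAt I 𝓘(ℝ) ∞ f x) (hV : SmoothAlong I J φ V x) :
    SmoothAlong I J φ (fun y ↦ f y • V y) x := by
  have hx := FiberBundle.mem_baseSet_trivializationAt' (F := F) (E := fun y : N ↦ TangentSpace J y) (φ x)
  have hev := eventually_mem_baseSet _ hx hV.map.continuousAt
  rw [smoothAlong_iff _ hx] at *
  refine ⟨hV.1, (hf.smul hV.2).congr_of_eventuallyEq ?_⟩
  filter_upwards [hev] with y hy
  exact trivialization_smul hy _ _

lemma mdiffAlong_zero (hφ : MDifferentiableAt I J φ x) : MDiffAlong I J φ 0 x :=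
  (mdifferentiable_zeroSection ℝ (TangentSpace J) (φ x)).comp x hφ

lemma smoothAlong_zero (hφ : ContMDiffAt I J ∞ φ x) : SmoothAlong I J φ 0 x :=
  (contMDiff_zeroSection ℝ (TangentSpace J) (φ x)).comp x hφ

lemma MDiffAlong.sum {ι : Type*} {s : Finset ι} {V : ι → Π x : M, TangentSpace J (φ x)}
    (hφ : MDifferentiableAt I J φ x)
    (hV : ∀ i ∈ s, MDiffAlong I J φ (V i) x) : MDiffAlong I J φ (fun y ↦ ∑ i ∈ s, V i y) x := by
  classical
  induction s using Finset.induction_on with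
  | empty => simpa using! mdiffAlong_zero hφ
  | insert a s ha ih =>
    simp only [Finset.sum_insert ha]
    exact (hV a (by simp)).add (ih fun i hi ↦ hV i (by simp [hi]))

lemma SmoothAlong.sum {ι : Type*} {s : Finset ι} {V : ι → Π x : M, TangentSpace J (φ x)}
    (hφ : ContMDiffAt I J ∞ φ x)
    (hV : ∀ i ∈ s, SmoothAlong I J φ (V i) x) : SmoothAlong I J φ (fun y ↦ ∑ i ∈ s, V i y) x := by
  classical
  induction s using Finset.induction_on with
  | empty => simpa using! smoothAlong_zero hφ
  | insert a s ha ih =>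
    simp only [Finset.sum_insert ha]
    exact (hV a (by simp)).add (ih fun i hi ↦ hV i (by simp [hi]))

lemma SmoothAlong.sub (hV : SmoothAlong I J φ V x) (hW : SmoothAlong I J φ W x) :
    SmoothAlong I J φ (fun y ↦ V y - W y) x := by
  have h := hV.add (hW.smul (contMDiffAt_const (c := (-1 : ℝ))))
  refine h.congr (.of_forall fun y ↦ ?_)
  simp [sub_eq_add_neg]

lemma mdiffAlong_comp {s : Π y : N, TangentSpace J y} (hs : MDiffAt (T% s) (φ x))
    (hφ : MDifferentiableAt I J φ x) : MDiffAlong I J φ (fun y ↦ s (φ y)) x :=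
  hs.comp x hφ

lemma smoothAlong_comp {s : Π y : N, TangentSpace J y} (hs : CMDiffAt ∞ (T% s) (φ x))
    (hφ : ContMDiffAt I J ∞ φ x) : SmoothAlong I J φ (fun y ↦ s (φ y)) x :=
  hs.comp x hφ

lemma localFrameCoeff_eq {t : Trivialization F (π F (fun y : N ↦ TangentSpace J y))}
    [MemTrivializationAtlas t] {ι : Type*} (b : Module.Basis ι ℝ F) {p : N} (hp : p ∈ t.baseSet)
    (i : ι) (v : TangentSpace J p) :
    t.localFrameCoeff J b i p v = b.repr (t ⟨p, v⟩).2 i := by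
  simpa using t.localFrameCoeff_eq_coeff (I := J) (b := b) (s := FiberBundle.extend F v) hp (i := i)

lemma MDiffAlong.coeff {t : Trivialization F (π F (fun y : N ↦ TangentSpace J y))}
    [MemTrivializationAtlas t] {ι : Type*} (b : Module.Basis ι ℝ F) (hx : φ x ∈ t.baseSet) (i : ι)
    (hV : MDiffAlong I J φ V x) :
    MDifferentiableAt I 𝓘(ℝ) (fun y ↦ t.localFrameCoeff J b i (φ y) (V y)) x := by
  have h := ((mdiffAlong_iff t hx).1 hV).2
  have h2 : MDifferentiableAt I 𝓘(ℝ) (fun y ↦ (b.coord i).toContinuousLinearMap (t ⟨φ y, V y⟩).2) x :=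
    ((b.coord i).toContinuousLinearMap.differentiable.differentiableAt.mdifferentiableAt).comp x h
  refine h2.congr_of_eventuallyEq ?_
  filter_upwards [eventually_mem_baseSet _ hx hV.map.continuousAt] with y hy
  simp [localFrameCoeff_eq b hy]

lemma SmoothAlong.coeff {t : Trivialization F (π F (fun y : N ↦ TangentSpace J y))}
    [MemTrivializationAtlas t] {ι : Type*} (b : Module.Basis ι ℝ F) (hx : φ x ∈ t.baseSet) (i : ι)
    (hV : SmoothAlong I J φ V x) :
    ContMDiffAt I 𝓘(ℝ) ∞ (fun y ↦ t.localFrameCoeff J b i (φ y) (V y)) x := by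
  have h := ((smoothAlong_iff t hx).1 hV).2
  have h2 : ContMDiffAt I 𝓘(ℝ) ∞ (fun y ↦ (b.coord i).toContinuousLinearMap (t ⟨φ y, V y⟩).2) x :=
    ((b.coord i).toContinuousLinearMap.contDiff.contMDiff.contMDiffAt).comp x h
  refine h2.congr_of_eventuallyEq ?_
  filter_upwards [eventually_mem_baseSet _ hx hV.map.continuousAt] with y hy
  simp [localFrameCoeff_eq b hy]

lemma eq_sum_coeff_smul {t : Trivialization F (π F (fun y : N ↦ TangentSpace J y))}
    [MemTrivializationAtlas t] {ι : Type*} [Fintype ι] (b : Module.Basis ι ℝ F) {p : N}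
    (hp : p ∈ t.baseSet) (v : TangentSpace J p) :
    v = ∑ i, t.localFrameCoeff J b i p v • t.localFrame b i p := by
  simpa using t.eq_sum_localFrameCoeff_smul (I := J) (b := b) (s := FiberBundle.extend F v) hp

lemma smoothAt_localFrame {t : Trivialization F (π F (fun y : N ↦ TangentSpace J y))}
    [MemTrivializationAtlas t] {ι : Type*} (b : Module.Basis ι ℝ F) {p : N}
    (hp : p ∈ t.baseSet) (i : ι) : CMDiffAt ∞ (T% (t.localFrame b i)) p :=
  contMDiffAt_localFrame_of_mem ∞ t b i hp

lemma mdiffAt_localFrame {t : Trivialization F (π F (fun y : N ↦ TangentSpace J y))}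
    [MemTrivializationAtlas t] {ι : Type*} (b : Module.Basis ι ℝ F) {p : N}
    (hp : p ∈ t.baseSet) (i : ι) : MDiffAt (T% (t.localFrame b i)) p :=
  (smoothAt_localFrame b hp i).mdifferentiableAt (by simp)

section Inner

variable [RiemannianBundle (fun y : N ↦ TangentSpace J y)]
  [IsContMDiffRiemannianBundle J ∞ F (fun y : N ↦ TangentSpace J y)]

lemma MDiffAlong.inner (hV : MDiffAlong I J φ V x) (hW : MDiffAlong I J φ W x) :
    MDifferentiableAt I 𝓘(ℝ) (fun y ↦ (inner ℝ (V y) (W y) : ℝ)) x :=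
  MDifferentiableAt.inner_bundle (F := F) (E := fun y : N ↦ TangentSpace J y) hV hW

end Inner

section Differential

variable [IsManifold I ∞ M]

lemma smoothAlong_mfderiv (hφ : ContMDiff I J ∞ φ) {X : Π x : M, TangentSpace I x}
    (hX : CMDiffAt ∞ (T% X) x) : SmoothAlong I J φ (fun y ↦ mfderiv I J φ y (X y)) x :=
  ((hφ.contMDiff_tangentMap (m := ∞) (by simp)).contMDiffAt).comp x hX

lemma mdiffAlong_mfderiv (hφ : ContMDiff I J ∞ φ) {X : Π x : M, TangentSpace I x}
    (hX : MDiffAt (T% X) x) : MDiffAlong I J φ (fun y ↦ mfderiv I J φ y (X y)) x :=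
  (((hφ.contMDiff_tangentMap (m := ∞) (by simp)).mdifferentiable (by simp)).mdifferentiableAt).comp x
    hX

end Differential

end Along

end RiemannianGeometry

namespace RiemannianGeometry

/-! ## Smoothness of the Levi-Civita connection -/

section LeviCivitaSmooth

variable {E : Type*} [NormedAddCommGroup E] [NormedSpace ℝ E] [FiniteDimensional ℝ E]
  {H : Type*} [TopologicalSpace H] {I : ModelWithCorners ℝ E H}
  {M : Type*} [TopologicalSpace M] [ChartedSpace H M] [IsManifold I ∞ M] {x : M}

lemma smoothAt_mvfderiv_apply {g : M → ℝ} {X : Π x : M, TangentSpace I x}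
    (hg : ContMDiffAt I 𝓘(ℝ) ∞ g x) (hX : CMDiffAt ∞ (T% X) x) :
    ContMDiffAt I 𝓘(ℝ) ∞ (fun y ↦ mvfderiv I g y (X y)) x := by
  have h1 := hg.mfderiv_const (m := ∞) (by simp)
  have h2 : ContMDiffAt I (𝓘(ℝ).prod 𝓘(ℝ)) ∞
      (fun y ↦ TotalSpace.mk' ℝ (E := TangentSpace 𝓘(ℝ)) (g y) (mfderiv I 𝓘(ℝ) g y (X y))) x :=
    ContMDiffAt.clm_apply_of_inCoordinates (b₁ := id) (b₂ := g) (v := X) h1 hX hg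
  rw [contMDiffAt_totalSpace] at h2
  refine h2.2.congr_of_eventuallyEq (.of_forall fun y ↦ ?_)
  simp only [trivializationAt_model_space_apply]
  rfl

lemma smoothAt_mlieBracket {X Y : Π x : M, TangentSpace I x}
    (hX : CMDiffAt ∞ (T% X) x) (hY : CMDiffAt ∞ (T% Y) x) :
    CMDiffAt ∞ (T% (VectorField.mlieBracket I X Y)) x := by
  have : CompleteSpace E := FiniteDimensional.complete ℝ E
  have : IsManifold I ((⊤ : ℕ∞) + 1) M := ‹IsManifold I ∞ M›
  have : IsManifold I (minSmoothness ℝ 2) M := by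
    rw [minSmoothness_of_isRCLikeNormedField]
    exact .of_le (n := ∞) (by norm_cast)
  exact ContMDiffAt.mlieBracket_vectorField (m := ⊤) (n := ⊤) hX hY (by simp)

variable [RiemannianBundle (fun x : M ↦ TangentSpace I x)]
  [IsContMDiffRiemannianBundle I ∞ E (fun x : M ↦ TangentSpace I x)]

lemma smoothAt_inner {X Y : Π x : M, TangentSpace I x}
    (hX : CMDiffAt ∞ (T% X) x) (hY : CMDiffAt ∞ (T% Y) x) :
    ContMDiffAt I 𝓘(ℝ) ∞ (fun y ↦ (inner ℝ (X y) (Y y) : ℝ)) x :=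
  ContMDiffAt.inner_bundle (F := E) (E := fun x : M ↦ TangentSpace I x) hX hY

lemma smoothAt_gramSchmidt {ι : Type*} [LinearOrder ι] [LocallyFiniteOrderBot ι] [WellFoundedLT ι]
    {s : ι → Π x : M, TangentSpace I x} (hs : ∀ i, CMDiffAt ∞ (T% (s i)) x)
    (hli : LinearIndependent ℝ (fun i ↦ s i x)) (i : ι) :
    CMDiffAt ∞ (T% (fun y ↦ InnerProductSpace.gramSchmidt ℝ (fun i ↦ s i y) i)) x := by
  induction i using WellFoundedLT.induction with
  | ind n ih =>
    have hne : ∀ j, InnerProductSpace.gramSchmidt ℝ (fun i ↦ s i x) j ≠ 0 := fun j ↦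
      InnerProductSpace.gramSchmidt_ne_zero j hli
    have hc : ∀ j < n, ContMDiffAt I 𝓘(ℝ) ∞ (fun y ↦
        (inner ℝ (InnerProductSpace.gramSchmidt ℝ (fun i ↦ s i y) j) (s n y) : ℝ) /
        inner ℝ (InnerProductSpace.gramSchmidt ℝ (fun i ↦ s i y) j)
          (InnerProductSpace.gramSchmidt ℝ (fun i ↦ s i y) j)) x := fun j hj ↦
      (smoothAt_inner (ih j hj) (hs n)).div₀ (smoothAt_inner (ih j hj) (ih j hj))
        (by simpa using hne j)
    have h : CMDiffAt ∞ (T% (fun y ↦ ∑ j ∈ Finset.Iio n,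
        ((inner ℝ (InnerProductSpace.gramSchmidt ℝ (fun i ↦ s i y) j) (s n y) : ℝ) /
        inner ℝ (InnerProductSpace.gramSchmidt ℝ (fun i ↦ s i y) j)
          (InnerProductSpace.gramSchmidt ℝ (fun i ↦ s i y) j)) •
          InnerProductSpace.gramSchmidt ℝ (fun i ↦ s i y) j)) x :=
      ContMDiffAt.sum_section fun j hj ↦
        (hc j (Finset.mem_Iio.1 hj)).smul_section (ih j (Finset.mem_Iio.1 hj))
    refine ((hs n).sub_section h).congr_of_eventuallyEq (.of_forall fun y ↦ ?_)
    have h0 := InnerProductSpace.gramSchmidt_def'' ℝ (fun i ↦ s i y) n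
    simp only [real_inner_self_eq_norm_sq]
    exact congrArg (TotalSpace.mk' E y) (eq_sub_of_add_eq h0.symm)

variable (I) in
/-- Near each point, there is a smooth orthonormal frame. -/
lemma exists_smooth_orthonormal_frame (x : M) :
    ∃ f : Fin (Module.finrank ℝ E) → Π y : M, TangentSpace I y,
      (∀ i, CMDiffAt ∞ (T% (f i)) x) ∧
      ∀ᶠ y in 𝓝 x, ∃ b : OrthonormalBasis (Fin (Module.finrank ℝ E)) ℝ (TangentSpace I y),
        ∀ i, b i = f i y := by
  let t := trivializationAt E (fun y : M ↦ TangentSpace I y) x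
  let b := Module.finBasis ℝ E
  have hx : x ∈ t.baseSet := FiberBundle.mem_baseSet_trivializationAt' x
  let s := t.localFrame b
  have hfr := t.isLocalFrameOn_localFrame_baseSet I 1 b
  have hli : ∀ y ∈ t.baseSet, LinearIndependent ℝ (fun i ↦ s i y) := fun y hy ↦
    hfr.linearIndependent hy
  refine ⟨fun i y ↦ InnerProductSpace.gramSchmidtNormed ℝ (fun i ↦ s i y) i, fun i ↦ ?_, ?_⟩
  · have hg := smoothAt_gramSchmidt (fun i ↦ smoothAt_localFrame b hx i) (hli x hx) i
    have hne := InnerProductSpace.gramSchmidt_ne_zero i (hli x hx)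
    have h1 : ContMDiffAt I 𝓘(ℝ) ∞
        (fun y ↦ ‖InnerProductSpace.gramSchmidt ℝ (fun i ↦ s i y) i‖⁻¹) x := by
      have h2 : ContMDiffAt I 𝓘(ℝ) ∞
          (fun y ↦ √(inner ℝ (InnerProductSpace.gramSchmidt ℝ (fun i ↦ s i y) i)
            (InnerProductSpace.gramSchmidt ℝ (fun i ↦ s i y) i))) x :=
        ((Real.contDiffAt_sqrt (by simpa using hne)).contMDiffAt).comp x (smoothAt_inner hg hg)
      refine (h2.inv₀ ?_).congr_of_eventuallyEq (.of_forall fun y ↦ ?_)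
      · rw [← norm_eq_sqrt_real_inner]
        exact norm_ne_zero_iff.2 hne
      · exact congrArg (·⁻¹) (norm_eq_sqrt_real_inner _)
    exact h1.smul_section hg
  · filter_upwards [t.open_baseSet.mem_nhds hx] with y hy
    refine ⟨OrthonormalBasis.mk (InnerProductSpace.gramSchmidtNormed_orthonormal (hli y hy)) ?_,
      fun i ↦ congrFun (OrthonormalBasis.coe_mk _ _) i⟩
    rw [InnerProductSpace.span_gramSchmidtNormed_range, InnerProductSpace.span_gramSchmidt]
    exact hfr.generating hy

lemma smoothAt_dInner {X Y Z : Π x : M, TangentSpace I x} (hX : CMDiffAt ∞ (T% X) x)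
    (hY : CMDiffAt ∞ (T% Y) x) (hZ : CMDiffAt ∞ (T% Z) x) :
    ContMDiffAt I 𝓘(ℝ) ∞ (fun y ↦ dInner I X Y y (Z y)) x :=
  smoothAt_mvfderiv_apply (smoothAt_inner hX hY) hZ

lemma smoothAt_koszul {X Y Z : Π x : M, TangentSpace I x} (hX : CMDiffAt ∞ (T% X) x)
    (hY : CMDiffAt ∞ (T% Y) x) (hZ : CMDiffAt ∞ (T% Z) x) :
    ContMDiffAt I 𝓘(ℝ) ∞ (fun y ↦ koszul I X Y Z y) x := by
  have h1 := smoothAt_dInner hY hZ hX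
  have h2 := smoothAt_dInner hZ hX hY
  have h3 := smoothAt_dInner hX hY hZ
  have h4 := smoothAt_inner (smoothAt_mlieBracket hX hY) hZ
  have h5 := smoothAt_inner (smoothAt_mlieBracket hY hZ) hX
  have h6 := smoothAt_inner (smoothAt_mlieBracket hZ hX) hY
  exact (((((h1.add h2).sub h3).add h4).sub h5).add h6).div_const 2

/-- The Levi-Civita connection maps smooth vector fields to smooth vector fields. -/
lemma smoothAt_leviCivita {X Y : Π x : M, TangentSpace I x} (hX : CMDiffAt ∞ (T% X) x)
    (hY : CMDiffAt ∞ (T% Y) x) :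
    CMDiffAt ∞ (T% (fun y ↦ leviCivita I M Y y (X y))) x := by
  obtain ⟨f, hf, hb⟩ := exists_smooth_orthonormal_frame I x
  have h : CMDiffAt ∞ (T% (fun y ↦ ∑ j, koszul I X Y (f j) y • f j y)) x :=
    ContMDiffAt.sum_section fun j _ ↦ (smoothAt_koszul hX hY (hf j)).smul_section (hf j)
  refine h.congr_of_eventuallyEq ?_
  have hfm : ∀ᶠ y in 𝓝 x, ∀ j, MDiffAt (T% (f j)) y :=
    Filter.eventually_all.2 fun j ↦ eventually_mdifferentiableAt (hf j)
  filter_upwards [hb, hfm, eventually_mdifferentiableAt hX, eventually_mdifferentiableAt hY]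
    with y ⟨b, hby⟩ hfy hXy hYy
  congr 1
  rw [← b.sum_repr' (leviCivita I M Y y (X y))]
  refine Finset.sum_congr rfl fun j _ ↦ ?_
  rw [hby j, ← inner_leviCivitaFun hXy hYy (hfy j), real_inner_comm]
  rfl

end LeviCivitaSmooth

end RiemannianGeometry

namespace RiemannianGeometry

/-! ## The induced connection on the pullback of the tangent bundle -/

section InducedConnection

variable {E : Type*} [NormedAddCommGroup E] [NormedSpace ℝ E] [FiniteDimensional ℝ E]
  {H : Type*} [TopologicalSpace H] {I : ModelWithCorners ℝ E H}
  {M : Type*} [TopologicalSpace M] [ChartedSpace H M] [IsManifold I ∞ M]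
  {F : Type*} [NormedAddCommGroup F] [NormedSpace ℝ F] [FiniteDimensional ℝ F]
  {G : Type*} [TopologicalSpace G] {J : ModelWithCorners ℝ F G}
  {N : Type*} [TopologicalSpace N] [ChartedSpace G N] [IsManifold J ∞ N]
  [RiemannianBundle (fun y : N ↦ TangentSpace J y)]
  [IsContMDiffRiemannianBundle J ∞ F (fun y : N ↦ TangentSpace J y)]
  {φ : M → N} {V W : Π x : M, TangentSpace J (φ x)} {f : M → ℝ} {x : M}

lemma inducedConnection_apply (V : Π x : M, TangentSpace J (φ x)) (x : M) (v : TangentSpace I x) :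
    inducedConnection I J φ V x v =
      ∑ a, (mvfderiv I (fun y ↦ (trivializationAt F (fun y : N ↦ TangentSpace J y)
            (φ x)).localFrameCoeff J (Module.finBasis ℝ F) a (φ y) (V y)) x v •
          (trivializationAt F (fun y : N ↦ TangentSpace J y) (φ x)).localFrame
            (Module.finBasis ℝ F) a (φ x) +
        (trivializationAt F (fun y : N ↦ TangentSpace J y) (φ x)).localFrameCoeff J
            (Module.finBasis ℝ F) a (φ x) (V x) •
          leviCivita J N ((trivializationAt F (fun y : N ↦ TangentSpace J y) (φ x)).localFrame
            (Module.finBasis ℝ F) a) (φ x) (mfderiv I J φ x v)) := by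
  simp only [inducedConnection, sum_apply, add_apply, smul_apply,
    ContinuousLinearMap.smulRight_apply, ContinuousLinearMap.comp_apply]

lemma inducedConnection_congr (h : ∀ᶠ y in 𝓝 x, V y = W y) :
    inducedConnection I J φ V x = inducedConnection I J φ W x := by
  ext1 v
  have hx := h.self_of_nhds
  simp only [inducedConnection_apply, hx]
  refine Finset.sum_congr rfl fun a _ ↦ ?_
  congr 2
  simp only [mvfderiv]
  have he : (fun y ↦ (trivializationAt F (fun y : N ↦ TangentSpace J y)
      (φ x)).localFrameCoeff J (Module.finBasis ℝ F) a (φ y) (V y)) =ᶠ[𝓝 x]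
      (fun y ↦ (trivializationAt F (fun y : N ↦ TangentSpace J y)
      (φ x)).localFrameCoeff J (Module.finBasis ℝ F) a (φ y) (W y)) :=
    h.mono fun y hy ↦ by simp [hy]
  rw [he.mfderiv_eq]
  rfl

lemma inducedConnection_add (hV : MDiffAlong I J φ V x) (hW : MDiffAlong I J φ W x)
    (v : TangentSpace I x) :
    inducedConnection I J φ (V + W) x v =
      inducedConnection I J φ V x v + inducedConnection I J φ W x v := by
  have hx := FiberBundle.mem_baseSet_trivializationAt' (F := F) (E := fun y : N ↦ TangentSpace J y) (φ x)
  simp only [inducedConnection_apply, Pi.add_apply, map_add]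
  rw [← Finset.sum_add_distrib]
  refine Finset.sum_congr rfl fun a _ ↦ ?_
  have h := mvfderiv_add (hV.coeff (Module.finBasis ℝ F) hx a) (hW.coeff (Module.finBasis ℝ F) hx a)
  simp only [Pi.add_def] at h
  rw [h, add_apply, add_smul, add_smul]
  abel

lemma inducedConnection_smul (hf : MDifferentiableAt I 𝓘(ℝ) f x) (hV : MDiffAlong I J φ V x)
    (v : TangentSpace I x) :
    inducedConnection I J φ (fun y ↦ f y • V y) x v =
      f x • inducedConnection I J φ V x v + mvfderiv I f x v • V x := by
  have hx := FiberBundle.mem_baseSet_trivializationAt' (F := F) (E := fun y : N ↦ TangentSpace J y) (φ x)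
  conv_rhs => rw [eq_sum_coeff_smul (Module.finBasis ℝ F) hx (V x)]
  simp only [inducedConnection_apply, map_smul, Finset.smul_sum]
  rw [← Finset.sum_add_distrib]
  refine Finset.sum_congr rfl fun a _ ↦ ?_
  have h := mvfderiv_mul hf (hV.coeff (Module.finBasis ℝ F) hx a)
  simp only [Pi.mul_def] at h
  simp only [smul_eq_mul]
  rw [h]
  simp only [add_apply, smul_apply, smul_eq_mul]
  module

lemma inducedConnection_zero (hφ : MDifferentiableAt I J φ x) (v : TangentSpace I x) :
    inducedConnection I J φ (0 : Π x : M, TangentSpace J (φ x)) x v = 0 := by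
  have h := inducedConnection_add (mdiffAlong_zero hφ) (mdiffAlong_zero hφ) v
  simpa using h

lemma inducedConnection_sum {ι : Type*} {s : Finset ι} {V : ι → Π x : M, TangentSpace J (φ x)}
    (hφ : MDifferentiableAt I J φ x)
    (hV : ∀ i ∈ s, MDiffAlong I J φ (V i) x) (v : TangentSpace I x) :
    inducedConnection I J φ (fun y ↦ ∑ i ∈ s, V i y) x v =
      ∑ i ∈ s, inducedConnection I J φ (V i) x v := by
  classical
  induction s using Finset.induction_on with
  | empty => simpa using! inducedConnection_zero hφ v
  | insert a s ha ih =>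
    simp only [Finset.sum_insert ha]
    rw [← ih fun i hi ↦ hV i (by simp [hi])]
    exact inducedConnection_add (hV a (by simp)) (.sum hφ fun i hi ↦ hV i (by simp [hi])) v

lemma leviCivita_smul {f : N → ℝ} {s : Π y : N, TangentSpace J y} {p : N}
    (hs : MDiffAt (T% s) p) (hf : MDiffAt f p) (w : TangentSpace J p) :
    leviCivita J N (fun y ↦ f y • s y) p w =
      f p • leviCivita J N s p w + mvfderiv J f p w • s p := by
  have h := (leviCivita J N).isCovariantDerivativeOnUniv.leibniz hs hf
  exact congr($h w)

lemma leviCivita_add {s s' : Π y : N, TangentSpace J y} {p : N}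
    (hs : MDiffAt (T% s) p) (hs' : MDiffAt (T% s') p) (w : TangentSpace J p) :
    leviCivita J N (s + s') p w = leviCivita J N s p w + leviCivita J N s' p w := by
  have h := (leviCivita J N).isCovariantDerivativeOnUniv.add hs hs'
  exact congr($h w)

lemma leviCivita_zero (p : N) :
    leviCivita J N (0 : Π y : N, TangentSpace J y) p = 0 := by
  rw [(leviCivita J N).zero]
  rfl

lemma leviCivita_sum {ι : Type*} {t : Finset ι} {s : ι → Π y : N, TangentSpace J y} {p : N}
    (hs : ∀ i ∈ t, MDiffAt (T% (s i)) p) (w : TangentSpace J p) :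
    leviCivita J N (fun y ↦ ∑ i ∈ t, s i y) p w = ∑ i ∈ t, leviCivita J N (s i) p w := by
  classical
  induction t using Finset.induction_on with
  | empty =>
    simp only [Finset.sum_empty]
    exact congr($(leviCivita_zero (J := J) p) w)
  | insert a t ha ih =>
    simp only [Finset.sum_insert ha]
    rw [← ih fun i hi ↦ hs i (by simp [hi])]
    exact leviCivita_add (hs a (by simp)) (.sum_section fun i hi ↦ hs i (by simp [hi])) w

/-- On pullbacks of vector fields, the induced connection is given by the connection of `N`. -/
lemma inducedConnection_comp {s : Π y : N, TangentSpace J y} (hs : MDiffAt (T% s) (φ x))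
    (hφ : MDifferentiableAt I J φ x) (v : TangentSpace I x) :
    inducedConnection I J φ (fun y ↦ s (φ y)) x v =
      leviCivita J N s (φ x) (mfderiv I J φ x v) := by
  let t := trivializationAt F (fun y : N ↦ TangentSpace J y) (φ x)
  have hx : φ x ∈ t.baseSet := FiberBundle.mem_baseSet_trivializationAt' (φ x)
  let b := Module.finBasis ℝ F
  have hc : ∀ a, MDiffAt (fun y ↦ t.localFrameCoeff J b a y (s y)) (φ x) := fun a ↦
    mdifferentiableAt_localFrameCoeff b hx hs a
  have hfr : ∀ a, MDiffAt (T% (t.localFrame b a)) (φ x) := fun a ↦ mdiffAt_localFrame b hx a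
  have hloc : leviCivita J N s (φ x) =
      leviCivita J N (fun y ↦ ∑ a, t.localFrameCoeff J b a y (s y) • t.localFrame b a y) (φ x) :=
    (leviCivita J N).isCovariantDerivativeOnUniv.congr_of_eventuallyEq hs
      (.sum_section fun a _ ↦ (hc a).smul_section (hfr a)) Filter.univ_mem
      (t.eventually_eq_localFrame_sum_coeff_smul b hx)
  rw [hloc, leviCivita_sum (s := fun a y ↦ t.localFrameCoeff J b a y (s y) • t.localFrame b a y)
    fun a _ ↦ (hc a).smul_section (hfr a), inducedConnection_apply]
  refine Finset.sum_congr rfl fun a _ ↦ ?_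
  rw [leviCivita_smul (hfr a) (hc a), add_comm]
  congr 2
  exact mvfderiv_comp_apply x (hc a) hφ v

/-- The induced connection in any local frame of `TN` given by a trivialization. -/
lemma inducedConnection_eq {t : Trivialization F (π F (fun y : N ↦ TangentSpace J y))}
    [MemTrivializationAtlas t] {ι : Type*} [Fintype ι] (b : Module.Basis ι ℝ F)
    (hx : φ x ∈ t.baseSet) (hV : MDiffAlong I J φ V x) (v : TangentSpace I x) :
    inducedConnection I J φ V x v =
      ∑ a, (t.localFrameCoeff J b a (φ x) (V x) •
            leviCivita J N (t.localFrame b a) (φ x) (mfderiv I J φ x v) +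
          mvfderiv I (fun y ↦ t.localFrameCoeff J b a (φ y) (V y)) x v •
            t.localFrame b a (φ x)) := by
  have hφ := hV.map
  have hfr : ∀ a, MDiffAlong I J φ (fun y ↦ t.localFrame b a (φ y)) x := fun a ↦
    mdiffAlong_comp (mdiffAt_localFrame b hx a) hφ
  have hloc : ∀ᶠ y in 𝓝 x,
      V y = ∑ a, t.localFrameCoeff J b a (φ y) (V y) • t.localFrame b a (φ y) :=
    (eventually_mem_baseSet _ hx hφ.continuousAt).mono fun y hy ↦ eq_sum_coeff_smul b hy (V y)
  rw [inducedConnection_congr hloc,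
    inducedConnection_sum hφ fun a _ ↦ (hfr a).smul (hV.coeff b hx a)]
  refine Finset.sum_congr rfl fun a _ ↦ ?_
  rw [inducedConnection_smul (hV.coeff b hx a) (hfr a),
    inducedConnection_comp (mdiffAt_localFrame b hx a) hφ]

/-- The induced connection maps smooth sections to smooth sections. -/
lemma smoothAlong_inducedConnection (hφ : ContMDiff I J ∞ φ) (hV : SmoothAlong I J φ V x)
    {X : Π x : M, TangentSpace I x} (hX : CMDiffAt ∞ (T% X) x) :
    SmoothAlong I J φ (fun y ↦ inducedConnection I J φ V y (X y)) x := by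
  let t := trivializationAt F (fun y : N ↦ TangentSpace J y) (φ x)
  have hx : φ x ∈ t.baseSet := FiberBundle.mem_baseSet_trivializationAt' (φ x)
  let b := Module.finBasis ℝ F
  have hφx := hφ.contMDiffAt (x := x)
  have hdX := smoothAlong_mfderiv hφ hX
  have hs : ∀ a, SmoothAlong I J φ (fun y ↦ t.localFrame b a (φ y)) x := fun a ↦
    smoothAlong_comp (smoothAt_localFrame b hx a) hφx
  have h : SmoothAlong I J φ (fun y ↦ ∑ a, (t.localFrameCoeff J b a (φ y) (V y) •
      (∑ c, t.localFrameCoeff J b c (φ y) (mfderiv I J φ y (X y)) •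
        leviCivita J N (t.localFrame b a) (φ y) (t.localFrame b c (φ y))) +
      mvfderiv I (fun y ↦ t.localFrameCoeff J b a (φ y) (V y)) y (X y) •
        t.localFrame b a (φ y))) x := by
    refine .sum hφx fun a _ ↦ .add (.smul (hV.coeff b hx a) (.sum hφx fun c _ ↦
      .smul (hdX.coeff b hx c) ?_)) (.smul (smoothAt_mvfderiv_apply (hV.coeff b hx a) hX) (hs a))
    exact smoothAlong_comp (s := fun p ↦ leviCivita J N (t.localFrame b a) p (t.localFrame b c p))
      (smoothAt_leviCivita (smoothAt_localFrame b hx c) (smoothAt_localFrame b hx a)) hφx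
  refine h.congr ?_
  filter_upwards [eventually_mem_baseSet _ hx hφx.continuousAt, hV.eventually_mdiffAlong]
    with y hy hVy
  rw [inducedConnection_eq b hy hVy]
  refine Finset.sum_congr rfl fun a _ ↦ ?_
  congr 2
  conv_lhs => rw [eq_sum_coeff_smul b hy (mfderiv I J φ y (X y))]
  simp only [map_sum, map_smul]

end InducedConnection

end RiemannianGeometry

namespace RiemannianGeometry

/-! ## Metric compatibility of the induced connection -/

section Metric

variable {E : Type*} [NormedAddCommGroup E] [NormedSpace ℝ E] [FiniteDimensional ℝ E]
  {H : Type*} [TopologicalSpace H] {I : ModelWithCorners ℝ E H}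
  {M : Type*} [TopologicalSpace M] [ChartedSpace H M] [IsManifold I ∞ M]
  {F : Type*} [NormedAddCommGroup F] [NormedSpace ℝ F] [FiniteDimensional ℝ F]
  {G : Type*} [TopologicalSpace G] {J : ModelWithCorners ℝ F G}
  {N : Type*} [TopologicalSpace N] [ChartedSpace G N] [IsManifold J ∞ N]
  [RiemannianBundle (fun y : N ↦ TangentSpace J y)]
  [IsContMDiffRiemannianBundle J ∞ F (fun y : N ↦ TangentSpace J y)]
  {φ : M → N} {V W : Π x : M, TangentSpace J (φ x)} {f : M → ℝ} {x : M}

lemma mvfderiv_congr {f g : M → ℝ} (h : ∀ᶠ y in 𝓝 x, f y = g y) :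
    mvfderiv I f x = mvfderiv I g x := by
  have he : f =ᶠ[𝓝 x] g := h
  simp only [mvfderiv]
  rw [he.mfderiv_eq]
  rfl

variable (I J) in
/-- The product rule for the derivative of `⟨V, W⟩` in the direction `v`. -/
def MetricProductRule (φ : M → N) (V W : Π x : M, TangentSpace J (φ x)) (x : M)
    (v : TangentSpace I x) : Prop :=
  mvfderiv I (fun y ↦ (inner ℝ (V y) (W y) : ℝ)) x v =
    inner ℝ (inducedConnection I J φ V x v) (W x) + inner ℝ (V x) (inducedConnection I J φ W x v)

lemma MetricProductRule.symm {v : TangentSpace I x} (h : MetricProductRule I J φ V W x v) :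
    MetricProductRule I J φ W V x v := by
  unfold MetricProductRule at *
  have he : (fun y ↦ (inner ℝ (W y) (V y) : ℝ)) = fun y ↦ inner ℝ (V y) (W y) :=
    funext fun y ↦ real_inner_comm _ _
  rw [he, h, add_comm, real_inner_comm, real_inner_comm _ (W x)]

lemma MetricProductRule.congr {V' : Π x : M, TangentSpace J (φ x)} {v : TangentSpace I x}
    (h : MetricProductRule I J φ V W x v)
    (hV : ∀ᶠ y in 𝓝 x, V' y = V y) : MetricProductRule I J φ V' W x v := by
  unfold MetricProductRule at *
  rw [inducedConnection_congr hV, hV.self_of_nhds, ← h]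
  congr 1
  exact mvfderiv_congr (hV.mono fun y hy ↦ by rw [hy])

lemma MetricProductRule.add {V' : Π x : M, TangentSpace J (φ x)} {v : TangentSpace I x}
    (hV : MDiffAlong I J φ V x) (hV' : MDiffAlong I J φ V' x) (hW : MDiffAlong I J φ W x)
    (h : MetricProductRule I J φ V W x v) (h' : MetricProductRule I J φ V' W x v) :
    MetricProductRule I J φ (V + V') W x v := by
  unfold MetricProductRule at *
  have h1 := mvfderiv_add (hV.inner hW) (hV'.inner hW)
  simp only [Pi.add_def] at h1
  rw [inducedConnection_add hV hV']
  simp only [Pi.add_apply, inner_add_left]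
  rw [h1, add_apply, h, h']
  ring

lemma MetricProductRule.smul {v : TangentSpace I x} (hf : MDifferentiableAt I 𝓘(ℝ) f x)
    (hV : MDiffAlong I J φ V x) (hW : MDiffAlong I J φ W x)
    (h : MetricProductRule I J φ V W x v) :
    MetricProductRule I J φ (fun y ↦ f y • V y) W x v := by
  unfold MetricProductRule at *
  have h1 := mvfderiv_mul hf (hV.inner hW)
  simp only [Pi.mul_def] at h1
  rw [inducedConnection_smul hf hV]
  simp only [inner_add_left, real_inner_smul_left]
  rw [h1]
  simp only [add_apply, smul_apply, smul_eq_mul]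
  rw [h]
  ring

lemma MetricProductRule.zero {v : TangentSpace I x} (hφ : MDifferentiableAt I J φ x) :
    MetricProductRule I J φ (0 : Π x : M, TangentSpace J (φ x)) W x v := by
  unfold MetricProductRule
  rw [inducedConnection_zero hφ]
  simp only [Pi.zero_apply, inner_zero_left, mvfderiv_const]
  simp

lemma MetricProductRule.sum {ι : Type*} {s : Finset ι} {V : ι → Π x : M, TangentSpace J (φ x)}
    {v : TangentSpace I x} (hV : ∀ i ∈ s, MDiffAlong I J φ (V i) x) (hW : MDiffAlong I J φ W x)
    (h : ∀ i ∈ s, MetricProductRule I J φ (V i) W x v) :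
    MetricProductRule I J φ (fun y ↦ ∑ i ∈ s, V i y) W x v := by
  classical
  induction s using Finset.induction_on with
  | empty => simpa using! MetricProductRule.zero hW.map
  | insert a s ha ih =>
    simp only [Finset.sum_insert ha]
    exact .add (hV a (by simp)) (.sum hW.map fun i hi ↦ hV i (by simp [hi])) hW (h a (by simp))
      (ih (fun i hi ↦ hV i (by simp [hi])) fun i hi ↦ h i (by simp [hi]))

lemma MetricProductRule.of_localFrame {t : Trivialization F (π F (fun y : N ↦ TangentSpace J y))}
    [MemTrivializationAtlas t] {ι : Type*} [Fintype ι] (b : Module.Basis ι ℝ F)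
    (hx : φ x ∈ t.baseSet) {v : TangentSpace I x}
    (hV : MDiffAlong I J φ V x) (hW : MDiffAlong I J φ W x)
    (h : ∀ a, MetricProductRule I J φ (fun y ↦ t.localFrame b a (φ y)) W x v) :
    MetricProductRule I J φ V W x v := by
  have hfr : ∀ a, MDiffAlong I J φ (fun y ↦ t.localFrame b a (φ y)) x := fun a ↦
    mdiffAlong_comp (mdiffAt_localFrame b hx a) hV.map
  have hloc : ∀ᶠ y in 𝓝 x,
      V y = ∑ a, t.localFrameCoeff J b a (φ y) (V y) • t.localFrame b a (φ y) :=
    (eventually_mem_baseSet _ hx hV.map.continuousAt).mono fun y hy ↦ eq_sum_coeff_smul b hy (V y)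
  exact (MetricProductRule.sum (fun a _ ↦ (hfr a).smul (hV.coeff b hx a)) hW fun a _ ↦
    (h a).smul (hV.coeff b hx a) (hfr a) hW).congr hloc

lemma metricProductRule_comp {s s' : Π y : N, TangentSpace J y} (hs : MDiffAt (T% s) (φ x))
    (hs' : MDiffAt (T% s') (φ x)) (hφ : MDifferentiableAt I J φ x) (v : TangentSpace I x) :
    MetricProductRule I J φ (fun y ↦ s (φ y)) (fun y ↦ s' (φ y)) x v := by
  unfold MetricProductRule
  have h := leviCivita_metric (FiberBundle.mdifferentiableAt_extend J F (mfderiv I J φ x v)) hs hs'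
  rw [FiberBundle.extend_apply_self] at h
  rw [inducedConnection_comp hs hφ, inducedConnection_comp hs' hφ, ← h]
  exact mvfderiv_comp_apply x (mdifferentiableAt_inner hs hs') hφ v

/-- The induced connection is compatible with the metric. -/
lemma inducedConnection_metric (hV : MDiffAlong I J φ V x) (hW : MDiffAlong I J φ W x)
    (v : TangentSpace I x) :
    mvfderiv I (fun y ↦ (inner ℝ (V y) (W y) : ℝ)) x v =
      inner ℝ (inducedConnection I J φ V x v) (W x) +
        inner ℝ (V x) (inducedConnection I J φ W x v) := by
  let t := trivializationAt F (fun y : N ↦ TangentSpace J y) (φ x)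
  have hx : φ x ∈ t.baseSet := FiberBundle.mem_baseSet_trivializationAt' (φ x)
  let b := Module.finBasis ℝ F
  have hs : ∀ a, MDiffAt (T% (t.localFrame b a)) (φ x) := mdiffAt_localFrame b hx
  refine MetricProductRule.of_localFrame b hx hV hW fun a ↦ .symm ?_
  refine .of_localFrame b hx hW (mdiffAlong_comp (hs a) hV.map) fun c ↦ ?_
  exact metricProductRule_comp (hs c) (hs a) hV.map v

end Metric

/-! ## Smoothness of the tension field -/

section Tension

variable {E : Type*} [NormedAddCommGroup E] [NormedSpace ℝ E] [FiniteDimensional ℝ E]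
  {H : Type*} [TopologicalSpace H] {I : ModelWithCorners ℝ E H}
  {M : Type*} [TopologicalSpace M] [ChartedSpace H M] [IsManifold I ∞ M]
  [RiemannianBundle (fun x : M ↦ TangentSpace I x)]
  [IsContMDiffRiemannianBundle I ∞ E (fun x : M ↦ TangentSpace I x)]
  {F : Type*} [NormedAddCommGroup F] [NormedSpace ℝ F] [FiniteDimensional ℝ F]
  {G : Type*} [TopologicalSpace G] {J : ModelWithCorners ℝ F G}
  {N : Type*} [TopologicalSpace N] [ChartedSpace G N] [IsManifold J ∞ N]
  [RiemannianBundle (fun y : N ↦ TangentSpace J y)]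
  [IsContMDiffRiemannianBundle J ∞ F (fun y : N ↦ TangentSpace J y)]
  {φ : M → N} {x : M}

lemma tensorialAt_secondFundamentalForm_left (Y : Π x : M, TangentSpace I x) :
    TensorialAt I E (fun X ↦ secondFundamentalForm I J φ X Y x) x where
  smul _ _ := by
    simp only [secondFundamentalForm, Pi.smul_apply', map_smul, smul_sub]
  add _ _ := by
    simp only [secondFundamentalForm, Pi.add_apply, map_add]
    abel

lemma tensorialAt_secondFundamentalForm_right (hφ : ContMDiff I J ∞ φ)
    (X : Π x : M, TangentSpace I x) :
    TensorialAt I E (fun Y ↦ secondFundamentalForm I J φ X Y x) x where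
  smul {f Y} hf hY := by
    have h1 := inducedConnection_smul hf (mdiffAlong_mfderiv hφ hY) (X x)
    have h2 := leviCivita_smul hY hf (X x)
    change inducedConnection I J φ (fun y ↦ mfderiv I J φ y (f y • Y y)) x (X x) -
      mfderiv I J φ x (leviCivita I M (fun y ↦ f y • Y y) x (X x)) = _
    rw [h2]
    simp only [map_smul, map_add, secondFundamentalForm]
    rw [h1]
    module
  add {Y Y'} hY hY' := by
    have h1 := inducedConnection_add (mdiffAlong_mfderiv hφ hY) (mdiffAlong_mfderiv hφ hY') (X x)
    have h2 := leviCivita_add hY hY' (X x)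
    change inducedConnection I J φ (fun y ↦ mfderiv I J φ y (Y y + Y' y)) x (X x) -
      mfderiv I J φ x (leviCivita I M (Y + Y') x (X x)) = _
    rw [h2]
    simp only [map_add, secondFundamentalForm]
    change inducedConnection I J φ ((fun y ↦ mfderiv I J φ y (Y y)) +
      fun y ↦ mfderiv I J φ y (Y' y)) x (X x) - _ = _
    rw [h1]
    module

/-- The trace of a vector-valued bilinear map does not depend on the orthonormal basis. -/
lemma sum_bilin_orthonormalBasis {U A ι κ : Type*} [NormedAddCommGroup U] [InnerProductSpace ℝ U]
    [AddCommGroup A] [Module ℝ A] [Fintype ι] [Fintype κ] (B : U →ₗ[ℝ] U →ₗ[ℝ] A)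
    (e : OrthonormalBasis ι ℝ U) (f : OrthonormalBasis κ ℝ U) :
    ∑ k, B (e k) (e k) = ∑ i, B (f i) (f i) := by
  classical
  have h : ∀ k, B (e k) (e k) =
      ∑ i, ∑ j, ((inner ℝ (f i) (e k) : ℝ) * inner ℝ (e k) (f j)) • B (f i) (f j) := fun k ↦ by
    conv_lhs => rw [← f.sum_repr' (e k)]
    simp only [map_sum, map_smul, LinearMap.sum_apply, LinearMap.smul_apply, Finset.smul_sum,
      smul_smul]
    rw [Finset.sum_comm]
    refine Finset.sum_congr rfl fun i _ ↦ Finset.sum_congr rfl fun j _ ↦ ?_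
    rw [real_inner_comm (f j), mul_comm]
  simp only [h]
  rw [Finset.sum_comm]
  refine Finset.sum_congr rfl fun i _ ↦ ?_
  rw [Finset.sum_comm]
  simp only [← Finset.sum_smul, e.sum_inner_mul_inner]
  simp [f.inner_eq_ite]

/-- The tension field is the trace of the second fundamental form in any frame that is orthonormal
at the given point. -/
lemma tensionField_eq (hφ : ContMDiff I J ∞ φ) {ι : Type*} [Fintype ι]
    (b : OrthonormalBasis ι ℝ (TangentSpace I x)) {f : ι → Π y : M, TangentSpace I y}
    (hf : ∀ i, MDiffAt (T% (f i)) x) (hb : ∀ i, b i = f i x) :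
    tensionField I J φ x = ∑ i, secondFundamentalForm I J φ (f i) (f i) x := by
  have H₁ : ∀ Y : Π x : M, TangentSpace I x, MDiffAt (T% Y) x →
      TensorialAt I E (fun X ↦ secondFundamentalForm I J φ X Y x) x := fun Y _ ↦
    tensorialAt_secondFundamentalForm_left Y
  have H₂ : ∀ X : Π x : M, TangentSpace I x, MDiffAt (T% X) x →
      TensorialAt I E (fun Y ↦ secondFundamentalForm I J φ X Y x) x := fun X _ ↦
    tensorialAt_secondFundamentalForm_right hφ X
  have h1 := fun i ↦ TensorialAt.mkHom₂_apply
    (Φ := fun X Y ↦ secondFundamentalForm I J φ X Y x) H₁ H₂ (hf i) (hf i)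
  have h2 := TensorialAt.mkHom₂_apply_eq_extend
    (Φ := fun X Y ↦ secondFundamentalForm I J φ X Y x) H₁ H₂
  generalize TensorialAt.mkHom₂ (fun X Y ↦ secondFundamentalForm I J φ X Y x) x H₁ H₂ = B at h1 h2
  have h3 := sum_bilin_orthonormalBasis
    (LinearMap.mk₂ ℝ (fun u v ↦ B u v) (by simp) (by simp) (by simp) (by simp)) (tangentONB I x) b
  simp only [LinearMap.mk₂_apply, hb, h1] at h3
  simp only [h2] at h3
  exact h3

/-- The tension field of a smooth map is smooth. -/
lemma smoothAlong_tensionField (hφ : ContMDiff I J ∞ φ) (x : M) :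
    SmoothAlong I J φ (tensionField I J φ) x := by
  obtain ⟨f, hf, hb⟩ := exists_smooth_orthonormal_frame I x
  have h : SmoothAlong I J φ (fun y ↦ ∑ i, (
      inducedConnection I J φ (fun y ↦ mfderiv I J φ y (f i y)) y (f i y) -
      mfderiv I J φ y (leviCivita I M (f i) y (f i y)))) x :=
    .sum hφ.contMDiffAt fun i _ ↦ .sub
      (smoothAlong_inducedConnection hφ (smoothAlong_mfderiv hφ (hf i)) (hf i))
      (smoothAlong_mfderiv hφ (smoothAt_leviCivita (hf i) (hf i)))
  refine h.congr ?_
  have hfm : ∀ᶠ y in 𝓝 x, ∀ j, MDiffAt (T% (f j)) y :=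
    Filter.eventually_all.2 fun j ↦ eventually_mdifferentiableAt (hf j)
  filter_upwards [hb, hfm] with y ⟨b, hby⟩ hfy
  exact tensionField_eq hφ b hfy hby

end Tension

end RiemannianGeometry

namespace RiemannianGeometry

/-! ## The Bochner formula and the curvature sign -/

section Curvature

variable {F : Type*} [NormedAddCommGroup F] [NormedSpace ℝ F] [FiniteDimensional ℝ F]
  {G : Type*} [TopologicalSpace G] {J : ModelWithCorners ℝ F G}
  {N : Type*} [TopologicalSpace N] [ChartedSpace G N] [IsManifold J ∞ N]
  [RiemannianBundle (fun y : N ↦ TangentSpace J y)]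
  [IsContMDiffRiemannianBundle J ∞ F (fun y : N ↦ TangentSpace J y)] {p : N}

lemma eventually_extend_smul (c : ℝ) (v : TangentSpace J p) :
    ∀ᶠ q in 𝓝 p, (FiberBundle.extend F (c • v) q : TangentSpace J q) =
      c • (FiberBundle.extend F v q : TangentSpace J q) := by
  have hp := FiberBundle.mem_baseSet_trivializationAt' (F := F) (E := fun y : N ↦ TangentSpace J y) p
  filter_upwards [(trivializationAt F (fun y : N ↦ TangentSpace J y) p).open_baseSet.mem_nhds hp]
    with q hq
  simp only [FiberBundle.extend]
  rw [trivialization_smul hp]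
  have h := ((trivializationAt F (fun y : N ↦ TangentSpace J y) p).symmₗ ℝ q).map_smul c
    ((trivializationAt F (fun y : N ↦ TangentSpace J y) p) ⟨p, v⟩).2
  rwa [Trivialization.symmₗ_apply _ hq, Trivialization.symmₗ_apply _ hq] at h

lemma leviCivita_congr {s s' : Π q : N, TangentSpace J q} (hs : MDiffAt (T% s) p)
    (h : ∀ᶠ q in 𝓝 p, s' q = s q) : leviCivita J N s' p = leviCivita J N s p := by
  have hs' : MDiffAt (T% s') p := hs.congr_of_eventuallyEq (h.mono fun q hq ↦ by simp [hq])
  exact (leviCivita J N).isCovariantDerivativeOnUniv.congr_of_eventuallyEq hs' hs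
    Filter.univ_mem h

lemma curvature_smul_self (c : ℝ) (v w : TangentSpace J p) : curvature J (c • v) v w = 0 := by
  have hV := FiberBundle.contMDiffAt_extend (k := ∞) J F v
  have hW := FiberBundle.contMDiffAt_extend (k := ∞) J F w
  have hVm := FiberBundle.mdifferentiableAt_extend J F v
  have hcov : MDiffAt (T% (fun q ↦ leviCivita J N (FiberBundle.extend F w) q
      (FiberBundle.extend F v q))) p := (smoothAt_leviCivita hV hW).mdifferentiableAt (by simp)
  have h1 := (leviCivita J N).isCovariantDerivativeOnUniv.smul_const c hcov
  have h2 : leviCivita J N (fun q ↦ leviCivita J N (FiberBundle.extend F w) q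
      (FiberBundle.extend F (c • v) q)) p =
      leviCivita J N (c • fun q ↦ leviCivita J N (FiberBundle.extend F w) q
      (FiberBundle.extend F v q)) p :=
    leviCivita_congr (MDifferentiableAt.smul_section mdifferentiableAt_const hcov)
      ((eventually_extend_smul c v).mono fun q hq ↦ by
        simp only [hq, map_smul, Pi.smul_apply])
  have : IsManifold J 2 N := .of_le (n := ∞) (by norm_cast)
  have h3 : VectorField.mlieBracket J (FiberBundle.extend F (c • v)) (FiberBundle.extend F v) p =
      c • VectorField.mlieBracket J (FiberBundle.extend F v) (FiberBundle.extend F v) p := by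
    rw [← VectorField.mlieBracket_const_smul_left hVm]
    exact Filter.EventuallyEq.mlieBracket_vectorField_eq (eventually_extend_smul c v)
      Filter.EventuallyEq.rfl
  simp only [curvature]
  rw [h2, h3, VectorField.mlieBracket_self, FiberBundle.extend_apply_self,
    FiberBundle.extend_apply_self]
  erw [h1]
  simp

lemma curvature_zero_right (u v : TangentSpace J p) : curvature J u v 0 = 0 := by
  have hZ : ∀ᶠ q in 𝓝 p, (FiberBundle.extend F (0 : TangentSpace J p) q : TangentSpace J q) = 0 :=
    (eventually_extend_smul (J := J) 0 (0 : TangentSpace J p)).mono fun q hq ↦ by simpa using hq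
  have hz : ∀ p : N, MDiffAt (T% (0 : Π q : N, TangentSpace J q)) p := fun p ↦
    mdifferentiable_zeroSection ℝ (TangentSpace J) p
  have hcov : ∀ᶠ q in 𝓝 p,
      leviCivita J N (FiberBundle.extend F (0 : TangentSpace J p)) q = 0 := by
    filter_upwards [eventually_eventually_nhds.2 hZ] with q hq
    rw [leviCivita_congr (hz q) hq, leviCivita_zero]
  have h0 : ∀ X : Π q : N, TangentSpace J q, leviCivita J N (fun q ↦
      leviCivita J N (FiberBundle.extend F (0 : TangentSpace J p)) q (X q)) p = 0 := fun X ↦ by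
    rw [leviCivita_congr (hz p) (hcov.mono fun q hq ↦ by rw [hq]; rfl), leviCivita_zero]
  simp only [curvature, h0, hcov.self_of_nhds]
  simp

/-- Non-positivity of `⟨R(u, v) v, u⟩` for arbitrary `u`, `v` under non-positive curvature. -/
lemma inner_curvature_nonpos (hN : NonposSectionalCurvature J N) (u v : TangentSpace J p) :
    inner ℝ (curvature J u v v) u ≤ 0 := by
  by_cases h : LinearIndependent ℝ ![u, v]
  · have h1 := hN p u v h
    have hpos : 0 < ‖u‖ ^ 2 * ‖v‖ ^ 2 - (inner ℝ u v : ℝ) ^ 2 := by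
      have hlt : |(inner ℝ u v : ℝ)| < ‖u‖ * ‖v‖ := by
        refine lt_of_le_of_ne (abs_real_inner_le_norm u v) fun heq ↦ ?_
        have hu : u ≠ 0 := h.ne_zero 0
        have hv : v ≠ 0 := h.ne_zero 1
        have h2 : |(inner ℝ u v : ℝ) / (‖u‖ * ‖v‖)| = 1 := by
          rw [abs_div, heq, abs_of_nonneg (by positivity), div_self]
          exact mul_ne_zero (norm_ne_zero_iff.2 hu) (norm_ne_zero_iff.2 hv)
        obtain ⟨-, r, -, hr⟩ := (abs_real_inner_div_norm_mul_norm_eq_one_iff u v).1 h2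
        have h3 := LinearIndependent.pair_iff.1 h r (-1) (by simp [hr])
        simp at h3
      have := sq_lt_sq' (by linarith [neg_abs_le (inner ℝ u v : ℝ), abs_nonneg (inner ℝ u v : ℝ)])
        (lt_of_le_of_lt (le_abs_self _) hlt)
      nlinarith
    unfold sectionalCurvature at h1
    exact (div_nonpos_iff.1 h1).elim (fun h2 ↦ absurd h2.2 (not_le.2 hpos)) fun h2 ↦ h2.1
  · by_cases hv : v = 0
    · rw [hv, curvature_zero_right, inner_zero_left]
    · obtain ⟨c, rfl⟩ : ∃ c : ℝ, c • v = u := by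
        by_contra hc
        push Not at hc
        refine h ((LinearIndependent.pair_symm_iff).1 ?_)
        exact (LinearIndependent.pair_iff' hv).2 hc
      rw [curvature_smul_self, inner_zero_left]

end Curvature

section Bochner

variable {E : Type*} [NormedAddCommGroup E] [NormedSpace ℝ E] [FiniteDimensional ℝ E]
  {H : Type*} [TopologicalSpace H] {I : ModelWithCorners ℝ E H}
  {M : Type*} [TopologicalSpace M] [ChartedSpace H M] [IsManifold I ∞ M]
  [RiemannianBundle (fun x : M ↦ TangentSpace I x)]
  [IsContMDiffRiemannianBundle I ∞ E (fun x : M ↦ TangentSpace I x)]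
  {F : Type*} [NormedAddCommGroup F] [NormedSpace ℝ F] [FiniteDimensional ℝ F]
  {G : Type*} [TopologicalSpace G] {J : ModelWithCorners ℝ F G}
  {N : Type*} [TopologicalSpace N] [ChartedSpace G N] [IsManifold J ∞ N]
  [RiemannianBundle (fun y : N ↦ TangentSpace J y)]
  [IsContMDiffRiemannianBundle J ∞ F (fun y : N ↦ TangentSpace J y)]
  {φ : M → N} {V : Π x : M, TangentSpace J (φ x)} {x : M}

lemma mvfderiv_normSq (hV : MDiffAlong I J φ V x) (v : TangentSpace I x) :
    mvfderiv I (fun y ↦ ‖V y‖ ^ 2) x v = 2 * inner ℝ (inducedConnection I J φ V x v) (V x) := by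
  simp only [← real_inner_self_eq_norm_sq]
  rw [inducedConnection_metric hV hV, real_inner_comm (V x)]
  ring

lemma mvfderiv_mvfderiv_normSq (hφ : ContMDiff I J ∞ φ) (hV : SmoothAlong I J φ V x)
    {X : Π x : M, TangentSpace I x} (hX : CMDiffAt ∞ (T% X) x) :
    mvfderiv I (fun y ↦ mvfderiv I (fun y ↦ ‖V y‖ ^ 2) y (X y)) x (X x) =
      2 * (inner ℝ (inducedConnection I J φ (fun y ↦ inducedConnection I J φ V y (X y)) x (X x))
        (V x) + ‖inducedConnection I J φ V x (X x)‖ ^ 2) := by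
  have hDV := (smoothAlong_inducedConnection hφ hV hX).mdiffAlong
  have hev : ∀ᶠ y in 𝓝 x, mvfderiv I (fun y ↦ ‖V y‖ ^ 2) y (X y) =
      (2 : ℝ) * inner ℝ (inducedConnection I J φ V y (X y)) (V y) :=
    hV.eventually_mdiffAlong.mono fun y hy ↦ mvfderiv_normSq hy _
  have h1 := mvfderiv_mul (mdifferentiableAt_const (c := (2 : ℝ)) (I := I) (x := x))
    (hDV.inner hV.mdiffAlong)
  simp only [Pi.mul_def] at h1
  rw [mvfderiv_congr hev, h1]
  simp only [add_apply, smul_apply, smul_eq_mul, mvfderiv_const]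
  rw [inducedConnection_metric hDV hV.mdiffAlong, real_inner_self_eq_norm_sq]
  simp

/-- The Bochner formula `Δ|V|² = 2 |∇̄V|² - 2 ⟨Δ̄V, V⟩`. -/
lemma laplacian_normSq (hφ : ContMDiff I J ∞ φ) (hV : SmoothAlong I J φ V x) :
    laplacian I (fun y ↦ ‖V y‖ ^ 2) x =
      2 * normSqInducedDeriv I J φ V x - 2 * inner ℝ (roughLaplacian I J φ V x) (V x) := by
  simp only [laplacian, normSqInducedDeriv, roughLaplacian, inner_neg_left, sum_inner,
    Finset.mul_sum, mul_neg, sub_neg_eq_add, ← Finset.sum_add_distrib, inner_sub_left]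
  refine Finset.sum_congr rfl fun i _ ↦ ?_
  rw [mvfderiv_mvfderiv_normSq hφ hV (FiberBundle.contMDiffAt_extend (k := ∞) I E _),
    mvfderiv_normSq hV.mdiffAlong, FiberBundle.extend_apply_self]
  ring

end Bochner

end RiemannianGeometry

theorem lemma4p2 {m n : ℕ}
    {M : Type*} [TopologicalSpace M] [ChartedSpace (EuclideanSpace ℝ (Fin m)) M]
    [IsManifold (𝓡 m) ∞ M] [RiemannianBundle (fun x : M ↦ TangentSpace (𝓡 m) x)]
    [IsContMDiffRiemannianBundle (𝓡 m) ∞ (EuclideanSpace ℝ (Fin m))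
      (fun x : M ↦ TangentSpace (𝓡 m) x)]
    {N : Type*} [TopologicalSpace N] [ChartedSpace (EuclideanSpace ℝ (Fin n)) N]
    [IsManifold (𝓡 n) ∞ N] [RiemannianBundle (fun y : N ↦ TangentSpace (𝓡 n) y)]
    [IsContMDiffRiemannianBundle (𝓡 n) ∞ (EuclideanSpace ℝ (Fin n))
      (fun y : N ↦ TangentSpace (𝓡 n) y)]
    (hN : RiemannianGeometry.NonposSectionalCurvature (𝓡 n) N)
    (φ : M → N) (hφ : RiemannianGeometry.IsBiharmonic (𝓡 m) (𝓡 n) φ) (x : M) :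
    2 * RiemannianGeometry.normSqInducedDeriv (𝓡 m) (𝓡 n) φ
        (RiemannianGeometry.tensionField (𝓡 m) (𝓡 n) φ) x ≤
      RiemannianGeometry.laplacian (𝓡 m)
        (fun y ↦ ‖RiemannianGeometry.tensionField (𝓡 m) (𝓡 n) φ y‖ ^ 2) x := by
  obtain ⟨hsm, hbi⟩ := hφ
  have hτ := RiemannianGeometry.smoothAlong_tensionField hsm x
  rw [RiemannianGeometry.laplacian_normSq hsm hτ]
  have h1 : RiemannianGeometry.roughLaplacian (𝓡 m) (𝓡 n) φ
      (RiemannianGeometry.tensionField (𝓡 m) (𝓡 n) φ) x =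
      RiemannianGeometry.curvatureOperator (𝓡 m) (𝓡 n) φ
        (RiemannianGeometry.tensionField (𝓡 m) (𝓡 n) φ) x := sub_eq_zero.1 (hbi x)
  have h2 : inner ℝ (RiemannianGeometry.curvatureOperator (𝓡 m) (𝓡 n) φ
      (RiemannianGeometry.tensionField (𝓡 m) (𝓡 n) φ) x)
      (RiemannianGeometry.tensionField (𝓡 m) (𝓡 n) φ x) ≤ 0 := by
    rw [RiemannianGeometry.curvatureOperator, sum_inner]
    exact Finset.sum_nonpos fun i _ ↦ RiemannianGeometry.inner_curvature_nonpos hN _ _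
  rw [h1]
  linarith
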